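/- For a field $\mathbb F$, let $W(\mathbb F)$ be the Witt group of $\mathbb F$: the set of classes $[B]$ of non-degenerate symmetric bilinear forms $B$ on finite-dimensional $\mathbb F$-vector spaces, where $[B_1]=[B_2]$ if $B_1\oplus M_1\cong B_2\oplus M_2$ for some metabolic forms $M_1,M_2$ (forms having a totally isotropic subspace of half the dimension), with the addition $\oplus$ induced by orthogonal direct sum. For $a\in\mathbb F^\ast$ write $[a]$ for the class of the rank one form $\langle a\rangle(x,y)=axy$. For a prime $q$, let $\partial_q\colon W(\mathbb Q)\to W(\mathbb F_q)$ be the composition of the map $W(\mathbb Q)\to W(\mathbb Q_q)$ given by extension of scalars with the second residue homomorphism $W(\mathbb Q_q)\to W(\mathbb F_q)$ for the uniformizer $q$, that is, the homomorphism with $[u]\mapsto 0$ and $[qu]\mapsto[\bar u]$ for every unit $u$ of $\mathbb Z_q$, where $\bar u$ is the reduction of $u$ modulo $q$. Let $\partial=\bigoplus_q\partial_q\colon W(\mathbb Q)\to\bigoplus_{q\text{ prime}}W(\mathbb F_q)$. For a knot $K$ with Seifert surface $S$ and Seifert form $V_S(\alpha,\beta)=\ell k(a,b^+)$ on $H_1(S;\mathbb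 Z)$ (where $a,b$ are curves on $S$ representing $\alpha,\beta$, and $b^+$ is a small push-off of $b$ in the positive normal direction), let $W(K)\in W(\mathbb Q)$ be the class of the form $V_S+V_S^\tau$ on $H_1(S;\mathbb Q)$, where $V_S^\tau(\alpha,\beta)=V_S(\beta,\alpha)$; it does not depend on $S$. The Witt span of $K$ is $$ws(K)=\min\{\operatorname{rank}B \mid \partial[B]=\partial(W(K))\},$$ where $B$ ranges over all non-degenerate symmetric bilinear forms of finite rank over $\mathbb Q$. **Theorem.** Let $K$ be a knot, let $p\equiv 1\pmod 4$ be a prime, and let $\beta\in\mathbb F_p$ be any non-square. Assume that $\partial_q(W(K))=0$ for all primes $q\neq p$. (i) If $\partial_p(W(K))=[\beta]\in W(\mathbb F_p)$, then $ws(K)=2$. (ii) If $\partial_p(W(K))=[1]\oplus[\beta]\in W(\mathbb F_p)$, then $ws(K)=3$. -/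

import Mathlib

noncomputable section

open Module TensorProduct

/-- A finite-dimensional vector space over `F` with a non-degenerate symmetric bilinear form. -/
structure SymForm (F : Type) [Field F] where
  V : Type
  [addCommGroup : AddCommGroup V]
  [module : Module F V]
  [finite : FiniteDimensional F V]
  B : LinearMap.BilinForm F V
  symm : ∀ x y, B x y = B y x
  nondeg : ∀ x, (∀ y, B x y = 0) → x = 0

attribute [instance] SymForm.addCommGroup SymForm.module SymForm.finite

/-- The space has a totally isotropic subspace of half its dimension. -/
def HalfIsotropic {F V : Type} [Field F] [AddCommGroup V] [Module F V]
    (B : LinearMap.BilinForm F V) : Prop :=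
  ∃ N : Submodule F V, (∀ x ∈ N, ∀ y ∈ N, B x y = 0) ∧ finrank F V = 2 * finrank F N

/-- The orthogonal direct sum of two bilinear forms. -/
def prodForm {F V W : Type} [Field F] [AddCommGroup V] [Module F V] [AddCommGroup W] [Module F W]
    (B : LinearMap.BilinForm F V) (C : LinearMap.BilinForm F W) :
    LinearMap.BilinForm F (V × W) :=
  B.comp (LinearMap.fst F V W) (LinearMap.fst F V W) +
    C.comp (LinearMap.snd F V W) (LinearMap.snd F V W)

section

variable {F V W : Type} [Field F] [AddCommGroup V] [Module F V] [AddCommGroup W] [Module F W]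

lemma prodForm_apply (B : LinearMap.BilinForm F V) (C : LinearMap.BilinForm F W) (x y : V × W) :
    prodForm B C x y = B x.1 y.1 + C x.2 y.2 := rfl

lemma HalfIsotropic.congr {B : LinearMap.BilinForm F V} {C : LinearMap.BilinForm F W}
    (h : HalfIsotropic B) (e : V ≃ₗ[F] W) (he : ∀ x y, C (e x) (e y) = B x y) :
    HalfIsotropic C := by
  obtain ⟨N, hN, hd⟩ := h
  refine ⟨N.map (e : V →ₗ[F] W), ?_, ?_⟩
  · rintro _ ⟨x, hx, rfl⟩ _ ⟨y, hy, rfl⟩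
    exact (he x y).trans (hN x hx y hy)
  · rw [← e.finrank_eq, hd, LinearEquiv.finrank_map_eq e N]

lemma HalfIsotropic.prod [FiniteDimensional F V] [FiniteDimensional F W]
    {B : LinearMap.BilinForm F V} {C : LinearMap.BilinForm F W}
    (h : HalfIsotropic B) (h' : HalfIsotropic C) : HalfIsotropic (prodForm B C) := by
  obtain ⟨N, hN, hd⟩ := h
  obtain ⟨N', hN', hd'⟩ := h'
  refine ⟨N.prod N', ?_, ?_⟩
  · rintro x ⟨hx, hx'⟩ y ⟨hy, hy'⟩
    simp [prodForm_apply, hN _ hx _ hy, hN' _ hx' _ hy']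
  · have h : finrank F (N.prod N') = finrank F N + finrank F N' := by
      rw [← Module.finrank_prod]
      exact LinearEquiv.finrank_eq
        { toFun := fun x => (⟨x.1.1, x.2.1⟩, ⟨x.1.2, x.2.2⟩)
          invFun := fun x => ⟨(x.1, x.2), x.1.2, x.2.2⟩
          map_add' := fun _ _ => rfl
          map_smul' := fun _ _ => rfl }
    rw [Module.finrank_prod, h]; omega

lemma HalfIsotropic.neg {B : LinearMap.BilinForm F V} (h : HalfIsotropic B) :
    HalfIsotropic (-B) := by
  obtain ⟨N, hN, hd⟩ := h
  exact ⟨N, fun x hx y hy => by simp [hN x hx y hy], hd⟩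

lemma HalfIsotropic.prod_neg [FiniteDimensional F V] (B : LinearMap.BilinForm F V) :
    HalfIsotropic (prodForm B (-B)) := by
  refine ⟨LinearMap.range (LinearMap.prod LinearMap.id LinearMap.id : V →ₗ[F] V × V), ?_, ?_⟩
  · rintro _ ⟨x, rfl⟩ _ ⟨y, rfl⟩
    exact add_neg_cancel (B x y)
  · rw [LinearMap.finrank_range_of_inj (fun x y h => congrArg Prod.fst h), Module.finrank_prod]
    omega

end

namespace SymForm

variable {F : Type} [Field F]

/-- The rank of a form: the dimension of the underlying space. -/
def rank (A : SymForm F) : ℕ := finrank F A.V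

/-- Two forms are isometric if there is a linear isomorphism that carries one to the other. -/
def Isometric (A B : SymForm F) : Prop :=
  ∃ e : A.V ≃ₗ[F] B.V, ∀ x y, B.B (e x) (e y) = A.B x y

/-- A form is metabolic if it has a totally isotropic subspace of half the dimension. -/
def Metabolic (A : SymForm F) : Prop := HalfIsotropic A.B

/-- The orthogonal direct sum. -/
def oplus (A B : SymForm F) : SymForm F where
  V := A.V × B.V
  B := prodForm A.B B.B
  symm x y := by simp [prodForm_apply, A.symm x.1, B.symm x.2]
  nondeg x h := by
    refine Prod.ext (A.nondeg _ fun y => ?_) (B.nondeg _ fun y => ?_)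
    · simpa [prodForm_apply] using h (y, 0)
    · simpa [prodForm_apply] using h (0, y)

/-- The form `(V, -B)`. -/
def neg (A : SymForm F) : SymForm F where
  V := A.V
  B := -A.B
  symm x y := by simp [A.symm x]
  nondeg x h := A.nondeg x fun y => by simpa using h y

/-- The form on the zero space. -/
def zero (F : Type) [Field F] : SymForm F where
  V := PUnit
  B := 0
  symm _ _ := rfl
  nondeg _ _ := rfl

/-- The form `⟨a⟩` of rank one, `(x, y) ↦ a x y`. -/
def rankOne (a : Fˣ) : SymForm F where
  V := F
  B := (a : F) • LinearMap.mul F F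
  symm x y := by simp [mul_comm x y]
  nondeg x h := by simpa using h 1

@[simp] lemma oplus_apply (A B : SymForm F) (x y : A.V × B.V) :
    (A.oplus B).B x y = A.B x.1 y.1 + B.B x.2 y.2 := rfl

@[simp] lemma neg_apply (A : SymForm F) (x y : A.V) : A.neg.B x y = -A.B x y := rfl

@[simp] lemma rankOne_apply (a : Fˣ) (x y : F) : (rankOne a).B x y = a * (x * y) := rfl

lemma Isometric.refl (A : SymForm F) : A.Isometric A := ⟨LinearEquiv.refl _ _, fun _ _ => rfl⟩

lemma Isometric.symm {A B : SymForm F} : A.Isometric B → B.Isometric A := by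
  rintro ⟨e, he⟩
  exact ⟨e.symm, fun x y => by simpa using (he (e.symm x) (e.symm y)).symm⟩

lemma Isometric.trans {A B C : SymForm F} : A.Isometric B → B.Isometric C → A.Isometric C := by
  rintro ⟨e, he⟩ ⟨f, hf⟩
  exact ⟨e.trans f, fun x y => by simp [hf, he]⟩

lemma Isometric.oplus {A B C D : SymForm F} : A.Isometric B → C.Isometric D →
    (A.oplus C).Isometric (B.oplus D) := by
  rintro ⟨e, he⟩ ⟨f, hf⟩
  exact ⟨e.prodCongr f, fun x y => congrArg₂ (· + ·) (he _ _) (hf _ _)⟩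

lemma Isometric.neg {A B : SymForm F} : A.Isometric B → A.neg.Isometric B.neg := by
  rintro ⟨e, he⟩
  exact ⟨e, fun x y => congrArg (- ·) (he x y)⟩

lemma oplus_comm (A B : SymForm F) : (A.oplus B).Isometric (B.oplus A) :=
  ⟨LinearEquiv.prodComm F A.V B.V, fun _ _ => add_comm _ _⟩

lemma oplus_assoc (A B C : SymForm F) :
    ((A.oplus B).oplus C).Isometric (A.oplus (B.oplus C)) :=
  ⟨LinearEquiv.prodAssoc F A.V B.V C.V, fun _ _ => (add_assoc _ _ _).symm⟩

lemma oplus_zero (A : SymForm F) : (A.oplus (zero F)).Isometric A :=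
  ⟨LinearEquiv.prodUnique (R := F) (M := A.V) (M₂ := PUnit), fun _ _ => (add_zero _).symm⟩

lemma oplus_swap (A B C D : SymForm F) :
    ((A.oplus B).oplus (C.oplus D)).Isometric ((A.oplus C).oplus (B.oplus D)) :=
  ⟨LinearEquiv.prodProdProdComm F A.V B.V C.V D.V, fun _ _ => add_add_add_comm _ _ _ _⟩

lemma metabolic_zero : (zero F).Metabolic :=
  ⟨⊥, fun _ _ _ _ => rfl, by
    change finrank F PUnit = 2 * finrank F (⊥ : Submodule F PUnit)
    simp [finrank_zero_of_subsingleton]⟩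

lemma Metabolic.of_isometric {A B : SymForm F} : A.Isometric B → A.Metabolic → B.Metabolic :=
  fun ⟨e, he⟩ h => HalfIsotropic.congr h e he

lemma Metabolic.oplus {A B : SymForm F} (h : A.Metabolic) (h' : B.Metabolic) :
    (A.oplus B).Metabolic := HalfIsotropic.prod h h'

lemma Metabolic.neg {A : SymForm F} (h : A.Metabolic) : A.neg.Metabolic := HalfIsotropic.neg h

lemma metabolic_oplus_neg (A : SymForm F) : (A.oplus A.neg).Metabolic :=
  HalfIsotropic.prod_neg A.B

/-- Witt equivalence: forms become isometric after adding metabolic forms. -/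
def WittEquiv (A B : SymForm F) : Prop :=
  ∃ M N : SymForm F, M.Metabolic ∧ N.Metabolic ∧ (A.oplus M).Isometric (B.oplus N)

lemma Isometric.wittEquiv {A B : SymForm F} (h : A.Isometric B) : A.WittEquiv B :=
  ⟨_, _, metabolic_zero, metabolic_zero, h.oplus (.refl _)⟩

lemma Metabolic.wittEquiv {A : SymForm F} (h : A.Metabolic) : A.WittEquiv (zero F) :=
  ⟨_, _, metabolic_zero, h, oplus_comm _ _⟩

lemma WittEquiv.trans {A B C : SymForm F} : A.WittEquiv B → B.WittEquiv C → A.WittEquiv C := by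
  rintro ⟨M, N, hM, hN, h⟩ ⟨M', N', hM', hN', h'⟩
  refine ⟨M.oplus M', N'.oplus N, hM.oplus hM', hN'.oplus hN, ?_⟩
  refine (oplus_assoc _ _ _).symm.trans <| (h.oplus (.refl _)).trans <|
    (oplus_assoc _ _ _).trans <| ((Isometric.refl _).oplus (oplus_comm _ _)).trans <|
    (oplus_assoc _ _ _).symm.trans <| (h'.oplus (.refl _)).trans (oplus_assoc _ _ _)

lemma WittEquiv.oplus {A B C D : SymForm F} : A.WittEquiv B → C.WittEquiv D →
    (A.oplus C).WittEquiv (B.oplus D) := by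
  rintro ⟨M, N, hM, hN, h⟩ ⟨M', N', hM', hN', h'⟩
  exact ⟨_, _, hM.oplus hM', hN.oplus hN', (oplus_swap _ _ _ _).trans <|
    (h.oplus h').trans (oplus_swap _ _ _ _)⟩

lemma neg_oplus (A B : SymForm F) : (A.oplus B).neg.Isometric (A.neg.oplus B.neg) :=
  ⟨LinearEquiv.refl F (A.V × B.V), fun _ _ => (neg_add _ _).symm⟩

lemma WittEquiv.neg {A B : SymForm F} : A.WittEquiv B → A.neg.WittEquiv B.neg := by
  rintro ⟨M, N, hM, hN, h⟩
  exact ⟨_, _, hM.neg, hN.neg, (neg_oplus _ _).symm.trans (h.neg.trans (neg_oplus _ _))⟩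

instance wittSetoid (F : Type) [Field F] : Setoid (SymForm F) where
  r := WittEquiv
  iseqv := ⟨fun A => (Isometric.refl A).wittEquiv,
    fun ⟨M, N, hM, hN, h⟩ => ⟨N, M, hN, hM, h.symm⟩, WittEquiv.trans⟩

end SymForm

/-- The additive group of the Witt ring of `F`. -/
def WittGroup (F : Type) [Field F] : Type 1 := Quotient (SymForm.wittSetoid F)

namespace WittGroup

variable {F : Type} [Field F]

/-- The Witt class `[A]`. -/
def mk (A : SymForm F) : WittGroup F := Quotient.mk _ A

instance : Zero (WittGroup F) := ⟨mk (SymForm.zero F)⟩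

instance : Add (WittGroup F) :=
  ⟨Quotient.map₂ SymForm.oplus fun _ _ h _ _ h' => SymForm.WittEquiv.oplus h h'⟩

instance : Neg (WittGroup F) := ⟨Quotient.map SymForm.neg fun _ _ h => SymForm.WittEquiv.neg h⟩

instance : AddCommGroup (WittGroup F) where
  nsmul := nsmulRec
  zsmul := zsmulRec
  add_assoc := by
    rintro ⟨A⟩ ⟨B⟩ ⟨C⟩; exact Quotient.sound (SymForm.oplus_assoc A B C).wittEquiv
  zero_add := by
    rintro ⟨A⟩
    exact Quotient.sound ((SymForm.oplus_comm _ _).trans (SymForm.oplus_zero A)).wittEquiv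
  add_zero := by rintro ⟨A⟩; exact Quotient.sound (SymForm.oplus_zero A).wittEquiv
  neg_add_cancel := by
    rintro ⟨A⟩
    exact Quotient.sound ((SymForm.metabolic_oplus_neg A).of_isometric
      (SymForm.oplus_comm _ _)).wittEquiv
  add_comm := by rintro ⟨A⟩ ⟨B⟩; exact Quotient.sound (SymForm.oplus_comm A B).wittEquiv

/-- The Witt class `[a]` of the rank one form `⟨a⟩`. -/
def unit (a : Fˣ) : WittGroup F := mk (SymForm.rankOne a)

lemma mk_oplus (A B : SymForm F) : mk (A.oplus B) = mk A + mk B := rfl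

lemma mk_neg (A : SymForm F) : mk A.neg = -mk A := rfl

lemma mk_eq_of_isometric {A B : SymForm F} (h : A.Isometric B) : mk A = mk B :=
  Quotient.sound h.wittEquiv

lemma mk_eq_zero {A : SymForm F} (h : A.Metabolic) : mk A = 0 := Quotient.sound h.wittEquiv

end WittGroup

/-! Diagonal forms, and additive maps out of the Witt group given on rank one forms. -/

/-- The bilinear form `∑ i, a i * x i * y i`. -/
def diagForm {F ι : Type} [Field F] [Fintype ι] (a : ι → Fˣ) : LinearMap.BilinForm F (ι → F) :=
  ∑ i, (a i : F) • (LinearMap.mul F F).compl₁₂ (LinearMap.proj i) (LinearMap.proj i)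

lemma diagForm_apply {F ι : Type} [Field F] [Fintype ι] (a : ι → Fˣ) (x y : ι → F) :
    diagForm a x y = ∑ i, (a i : F) * (x i * y i) := by
  simp [diagForm, LinearMap.sum_apply]

namespace SymForm

variable {F : Type} [Field F]

/-- The diagonal form `⟨a₁⟩ ⊕ ⋯ ⊕ ⟨aₙ⟩`. -/
def diag {ι : Type} [Fintype ι] (a : ι → Fˣ) : SymForm F where
  V := ι → F
  B := diagForm a
  symm x y := by simp only [diagForm_apply, mul_comm (x _)]
  nondeg x h := by
    classical
    ext i
    have := h (Pi.single i 1)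
    simpa [diagForm_apply, Pi.single_apply] using this

lemma diag_fin_zero (a : Fin 0 → Fˣ) : (diag a).Isometric (zero F) :=
  ⟨(0 : (Fin 0 → F) ≃ₗ[F] PUnit), fun (x y : Fin 0 → F) => by
    change (0 : F) = diagForm a x y
    simp [diagForm_apply]⟩

lemma diag_fin_succ {n : ℕ} (a : Fin (n + 1) → Fˣ) :
    ((rankOne (a 0)).oplus (diag fun i : Fin n => a i.succ)).Isometric (diag a) :=
  ⟨Fin.consLinearEquiv F (fun _ : Fin (n + 1) => F), fun (x y : F × (Fin n → F)) => by
    change diagForm a (Fin.cons x.1 x.2 : Fin (n + 1) → F) (Fin.cons y.1 y.2 : Fin (n + 1) → F) =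
      (a 0 : F) * (x.1 * y.1) + diagForm (fun i : Fin n => a i.succ) x.2 y.2
    rw [diagForm_apply, diagForm_apply, Fin.sum_univ_succ]
    simp⟩

lemma diag_reindex {ι κ : Type} [Fintype ι] [Fintype κ] (e : κ ≃ ι) (a : ι → Fˣ) :
    (diag a).Isometric (diag (a ∘ e)) :=
  ⟨LinearEquiv.funCongrLeft F F e, fun (x y : ι → F) => by
      change diagForm (a ∘ e) (x ∘ e) (y ∘ e) = diagForm a x y
      rw [diagForm_apply, diagForm_apply, ← e.sum_comp]
      rfl⟩

lemma mk_diag_fin {n : ℕ} (a : Fin n → Fˣ) :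
    WittGroup.mk (diag a) = ∑ i, WittGroup.unit (a i) := by
  induction n with
  | zero =>
    rw [Fin.sum_univ_zero]
    exact WittGroup.mk_eq_of_isometric (diag_fin_zero a)
  | succ n ih =>
    rw [Fin.sum_univ_succ, ← ih, ← WittGroup.mk_eq_of_isometric (diag_fin_succ a)]
    rfl

lemma mk_diag {ι : Type} [Fintype ι] (a : ι → Fˣ) :
    WittGroup.mk (diag a) = ∑ i, WittGroup.unit (a i) := by
  rw [WittGroup.mk_eq_of_isometric (diag_reindex (Fintype.equivFin ι).symm a), mk_diag_fin,
    ← (Fintype.equivFin ι).symm.sum_comp]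
  rfl

lemma exists_diag (h2 : (2 : F) ≠ 0) (A : SymForm F) :
    ∃ a : Fin (finrank F A.V) → Fˣ, A.Isometric (diag a) := by
  have : Invertible (2 : F) := invertibleOfNonzero h2
  obtain ⟨v, hv⟩ := LinearMap.BilinForm.exists_orthogonal_basis (B := A.B) ⟨A.symm⟩
  have hv' : ∀ i j, i ≠ j → A.B (v i) (v j) = 0 := fun i j hij => hv hij
  have h0 : ∀ i, A.B (v i) (v i) ≠ 0 := fun i hi => v.ne_zero i <| A.nondeg _ fun y => by
    rw [← v.sum_repr y, map_sum]
    refine Finset.sum_eq_zero fun j _ => ?_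
    rw [map_smul]
    rcases eq_or_ne i j with rfl | hij
    · simp [hi]
    · simp [hv' i j hij]
  refine ⟨fun i => Units.mk0 _ (h0 i), v.equivFun, fun x y => ?_⟩
  change diagForm _ (v.equivFun x) (v.equivFun y) = _
  rw [diagForm_apply]
  conv_rhs => rw [← v.sum_repr x, ← v.sum_repr y]
  simp only [map_sum, LinearMap.sum_apply, map_smul, LinearMap.smul_apply, Basis.equivFun_apply,
    Units.val_mk0, smul_eq_mul]
  refine Finset.sum_congr rfl fun i _ => ?_
  rw [Finset.sum_eq_single i]
  · ring
  · intro j _ hj; simp [hv' j i hj]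
  · simp

lemma diag_oplus {ι κ : Type} [Fintype ι] [Fintype κ] (a : ι → Fˣ) (b : κ → Fˣ) :
    ((diag a).oplus (diag b)).Isometric (diag (Sum.elim a b)) :=
  ⟨(LinearEquiv.sumArrowLequivProdArrow ι κ F F).symm, fun (x y : (ι → F) × (κ → F)) => by
    change diagForm (Sum.elim a b) (Sum.elim x.1 x.2) (Sum.elim y.1 y.2) =
      diagForm a x.1 y.1 + diagForm b x.2 y.2
    simp [diagForm_apply]⟩

lemma diag_neg {ι : Type} [Fintype ι] (a : ι → Fˣ) :
    (diag a).neg.Isometric (diag (-a)) :=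
  ⟨LinearEquiv.refl F (ι → F), fun (x y : ι → F) => by
    change diagForm (-a) x y = -diagForm a x y
    simp [diagForm_apply]⟩

end SymForm

namespace WittGroup

variable {F : Type} [Field F] {G : Type*} [AddCommGroup G]

/-- A function on units vanishes on metabolic diagonal forms. -/
def KillsMetabolic (φ : Fˣ → G) : Prop :=
  ∀ (ι : Type) [Fintype ι] (a : ι → Fˣ), (SymForm.diag a).Metabolic → ∑ i, φ (a i) = 0

lemma KillsMetabolic.neg {φ : Fˣ → G} (hφ : KillsMetabolic φ) (a : Fˣ) : φ (-a) = -φ a := by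
  have := hφ (Unit ⊕ Unit) (Sum.elim (fun _ => a) (-(fun _ => a))) <|
    (SymForm.metabolic_oplus_neg (SymForm.diag fun _ : Unit => a)).of_isometric <|
    ((SymForm.Isometric.refl _).oplus (SymForm.diag_neg _)).trans (SymForm.diag_oplus _ _)
  simp at this
  exact (neg_eq_of_add_eq_zero_right this).symm

lemma KillsMetabolic.eq_of_wittEquiv {φ : Fˣ → G} (hφ : KillsMetabolic φ) (h2 : (2 : F) ≠ 0)
    {ι κ : Type} [Fintype ι] [Fintype κ] {a : ι → Fˣ} {b : κ → Fˣ}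
    (h : (SymForm.diag a).WittEquiv (SymForm.diag b)) : ∑ i, φ (a i) = ∑ i, φ (b i) := by
  obtain ⟨M, N, hM, hN, h⟩ := h
  obtain ⟨m, hm⟩ := M.exists_diag h2
  obtain ⟨n, hn⟩ := N.exists_diag h2
  have e : (SymForm.diag (Sum.elim a m)).Isometric (SymForm.diag (Sum.elim b n)) :=
    (SymForm.diag_oplus _ _).symm.trans <| ((SymForm.Isometric.refl _).oplus hm.symm).trans <|
      h.trans <| ((SymForm.Isometric.refl _).oplus hn).trans (SymForm.diag_oplus _ _)
  have := hφ _ (Sum.elim (Sum.elim a m) (-(Sum.elim b n))) <|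
    (SymForm.metabolic_oplus_neg (SymForm.diag (Sum.elim a m))).of_isometric <|
    ((SymForm.Isometric.refl _).oplus (e.neg.trans (SymForm.diag_neg _))).trans
      (SymForm.diag_oplus _ _)
  have h1 := hφ _ m (hM.of_isometric hm)
  have h3 := hφ _ n (hN.of_isometric hn)
  simp [hφ.neg, h1, h3] at this
  exact sub_eq_zero.mp (by rw [sub_eq_add_neg]; exact this)

/-- The additive map on the Witt group with prescribed values on the classes `[a]`. -/
def lift (h2 : (2 : F) ≠ 0) (φ : Fˣ → G) (hφ : KillsMetabolic φ) : WittGroup F →+ G :=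
  AddMonoidHom.mk' (Quotient.lift (fun A : SymForm F => ∑ i, φ ((A.exists_diag h2).choose i))
    fun A B h => hφ.eq_of_wittEquiv h2 <| by
      have hA : (SymForm.diag (A.exists_diag h2).choose).WittEquiv A :=
        (A.exists_diag h2).choose_spec.symm.wittEquiv
      exact hA.trans (SymForm.WittEquiv.trans h (B.exists_diag h2).choose_spec.wittEquiv)) <| by
    rintro ⟨A⟩ ⟨B⟩
    change ∑ i, φ (((A.oplus B).exists_diag h2).choose i) =
      ∑ i, φ ((A.exists_diag h2).choose i) + ∑ i, φ ((B.exists_diag h2).choose i)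
    have : ∑ i, φ (((A.oplus B).exists_diag h2).choose i) =
        ∑ i, φ (Sum.elim (A.exists_diag h2).choose (B.exists_diag h2).choose i) :=
      hφ.eq_of_wittEquiv h2 <| SymForm.Isometric.wittEquiv <|
        ((A.oplus B).exists_diag h2).choose_spec.symm.trans <|
        ((A.exists_diag h2).choose_spec.oplus (B.exists_diag h2).choose_spec).trans
          (SymForm.diag_oplus _ _)
    rw [this, Fintype.sum_sum_type]
    rfl

lemma lift_unit (h2 : (2 : F) ≠ 0) (φ : Fˣ → G) (hφ : KillsMetabolic φ) (a : Fˣ) :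
    lift h2 φ hφ (unit a) = φ a := by
  have h : (SymForm.diag (fun _ : Unit => a)).Isometric (SymForm.rankOne a) :=
    ⟨LinearEquiv.funUnique Unit F F, fun (x y : Unit → F) => by
      change (a : F) * (x default * y default) = diagForm _ x y
      simp [diagForm_apply]⟩
  have := hφ.eq_of_wittEquiv h2 ((h.trans ((SymForm.rankOne a).exists_diag h2).choose_spec).wittEquiv)
  simp only [Finset.univ_unique, Finset.sum_singleton] at this
  exact this.symm

end WittGroup

/-! Extension of scalars. -/

section BaseChange

variable {F : Type} [Field F] (L : Type) [Field L] [Algebra F L]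

lemma baseChange_nondeg {V : Type} [AddCommGroup V] [Module F V] [FiniteDimensional F V]
    (B : LinearMap.BilinForm F V) (hs : ∀ x y, B x y = B y x) (h : ∀ x, (∀ y, B x y = 0) → x = 0)
    (x : L ⊗[F] V) (hx : ∀ y, B.baseChange L x y = 0) : x = 0 := by
  classical
  let b := Module.finBasis F V
  have hB : B.Nondegenerate := (LinearMap.IsRefl.nondegenerate_iff_separatingLeft
    (fun x y hxy => by rw [hs, hxy])).mpr h
  have h1 := (LinearMap.BilinForm.nondegenerate_iff_det_ne_zero b).mp hB
  have h2 : (LinearMap.BilinForm.toMatrix (b.baseChange L)) (B.baseChange L) =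
      (LinearMap.BilinForm.toMatrix b B).map (algebraMap F L) := by
    ext i j
    simp [LinearMap.BilinForm.toMatrix_apply, Algebra.algebraMap_eq_smul_one]
  have h3 : (B.baseChange L).Nondegenerate := by
    rw [LinearMap.BilinForm.nondegenerate_iff_det_ne_zero (b.baseChange L), h2]
    rw [← RingHom.mapMatrix_apply, ← RingHom.map_det]
    simpa using h1
  exact h3.1 x hx

lemma HalfIsotropic.baseChange {V : Type} [AddCommGroup V] [Module F V] [FiniteDimensional F V]
    {B : LinearMap.BilinForm F V} (h : HalfIsotropic B) : HalfIsotropic (B.baseChange L) := by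
  obtain ⟨N, hN, hd⟩ := h
  refine ⟨LinearMap.range (N.subtype.baseChange L), ?_, ?_⟩
  · rintro _ ⟨x, rfl⟩ _ ⟨y, rfl⟩
    induction x using TensorProduct.induction_on with
    | zero => simp
    | add x x' hx hx' => simp [hx, hx']
    | tmul l n =>
      induction y using TensorProduct.induction_on with
      | zero => simp
      | add y y' hy hy' => rw [map_add, map_add, hy, hy', add_zero]
      | tmul l' n' => simp [hN n n.2 n' n'.2]
  · rw [LinearMap.finrank_range_of_inj, Module.finrank_baseChange, Module.finrank_baseChange, hd]
    exact Module.Flat.lTensor_preserves_injective_linearMap (M := L) N.subtype N.injective_subtype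

/-- Extension of scalars of a form along a field extension. -/
def SymForm.baseChange (A : SymForm F) : SymForm L where
  V := L ⊗[F] A.V
  B := A.B.baseChange L
  symm x y := (LinearMap.BilinForm.IsSymm.baseChange (A := L) (B₂ := A.B) ⟨A.symm⟩).eq x y
  nondeg := baseChange_nondeg L A.B A.symm A.nondeg

lemma SymForm.Isometric.baseChange {A B : SymForm F} :
    A.Isometric B → (A.baseChange L).Isometric (B.baseChange L) := by
  rintro ⟨e, he⟩
  refine ⟨e.baseChange F L A.V B.V, fun (x y : L ⊗[F] A.V) => ?_⟩
  change B.B.baseChange L (e.baseChange F L A.V B.V x) (e.baseChange F L A.V B.V y) =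
    A.B.baseChange L x y
  induction x using TensorProduct.induction_on with
  | zero => simp
  | add x x' hx hx' => simp [hx, hx']
  | tmul l n =>
    induction y using TensorProduct.induction_on with
    | zero => simp
    | add y y' hy hy' => rw [map_add, map_add, map_add, hy, hy']
    | tmul l' n' => simp [he]

lemma SymForm.baseChange_oplus (A B : SymForm F) :
    ((A.oplus B).baseChange L).Isometric ((A.baseChange L).oplus (B.baseChange L)) := by
  refine ⟨TensorProduct.prodRight F L L A.V B.V, fun (x y : L ⊗[F] (A.V × B.V)) => ?_⟩
  change prodForm (A.B.baseChange L) (B.B.baseChange L) (TensorProduct.prodRight F L L A.V B.V x)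
    (TensorProduct.prodRight F L L A.V B.V y) = (prodForm A.B B.B).baseChange L x y
  induction x using TensorProduct.induction_on with
  | zero => simp
  | add x x' hx hx' => simp [hx, hx']
  | tmul l n =>
    induction y using TensorProduct.induction_on with
    | zero => simp
    | add y y' hy hy' => rw [map_add, map_add, map_add, hy, hy']
    | tmul l' n' => simp [prodForm_apply, add_smul]

/-- The map `W(F) → W(L)` induced by a field extension, `[A] ↦ [L ⊗ A]`. -/
def WittGroup.baseChange : WittGroup F →+ WittGroup L :=
  AddMonoidHom.mk' (Quotient.lift (fun A : SymForm F => WittGroup.mk (A.baseChange L)) <| by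
    rintro A B ⟨M, N, hM, hN, h⟩
    have := WittGroup.mk_eq_of_isometric <| (SymForm.baseChange_oplus L A M).symm.trans <|
      (h.baseChange L).trans (SymForm.baseChange_oplus L B N)
    have hM' : WittGroup.mk (M.baseChange L) = 0 :=
      WittGroup.mk_eq_zero (HalfIsotropic.baseChange L hM)
    have hN' : WittGroup.mk (N.baseChange L) = 0 :=
      WittGroup.mk_eq_zero (HalfIsotropic.baseChange L hN)
    rwa [WittGroup.mk_oplus, WittGroup.mk_oplus, hM', hN', add_zero, add_zero] at this) <| by
  rintro ⟨A⟩ ⟨B⟩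
  exact WittGroup.mk_eq_of_isometric (SymForm.baseChange_oplus L A B)

end BaseChange

/-! The residue maps. -/

lemma diagForm_nondegenerate {F ι : Type} [Field F] [Fintype ι] (a : ι → Fˣ) :
    (diagForm a).Nondegenerate :=
  (LinearMap.IsRefl.nondegenerate_iff_separatingLeft (fun x y hxy => by
    rw [← hxy]; exact (SymForm.diag a).symm y x)).mpr (SymForm.diag a).nondeg

lemma diagForm_halfIsotropic_iff {F ι : Type} [Field F] [Fintype ι] (a : ι → Fˣ) :
    HalfIsotropic (diagForm a) ↔ ∃ N : Submodule F (ι → F),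
      ∀ z, z ∈ N ↔ ∀ w ∈ N, diagForm a w z = 0 := by
  have key := LinearMap.BilinForm.finrank_orthogonal (diagForm_nondegenerate a)
  constructor
  · rintro ⟨N, hN, hd⟩
    have hle : N ≤ (diagForm a).orthogonal N := fun z hz w hw => hN w hw z hz
    have := Submodule.eq_of_le_of_finrank_eq hle (by rw [key, hd]; omega)
    refine ⟨N, fun z => ⟨fun hz w hw => hN w hw z hz, fun hz => ?_⟩⟩
    rw [this]; exact hz
  · rintro ⟨N, hN⟩
    have : (diagForm a).orthogonal N = N := by
      ext z; exact (hN z).symm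
    have h1 := key N
    rw [this] at h1
    have h2 := Submodule.finrank_le N
    exact ⟨N, fun x hx y hy => (hN y).mp hy x hx, by omega⟩

section Padic

variable {p : ℕ} [Fact p.Prime]

lemma toZMod_eq_zero_iff (x : ℤ_[p]) : PadicInt.toZMod x = 0 ↔ (p : ℤ_[p]) ∣ x := by
  rw [← RingHom.mem_ker, PadicInt.ker_toZMod, PadicInt.maximalIdeal_eq_span_p,
    Ideal.mem_span_singleton]

/-- The unit `u` in `a = u * p ^ v(a)`. -/
def padicUnitPart (a : ℚ_[p]ˣ) : ℤ_[p]ˣ :=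
  PadicInt.mkUnits (u := (a : ℚ_[p]) * (p : ℚ_[p]) ^ (-(a : ℚ_[p]).valuation)) <| by
    have hp : (p : ℝ) ≠ 0 := by exact_mod_cast (Fact.out : p.Prime).ne_zero
    rw [norm_mul, Padic.norm_eq_zpow_neg_valuation a.ne_zero, norm_zpow, Padic.norm_p,
      inv_zpow', neg_neg, ← zpow_add₀ hp, neg_add_cancel, zpow_zero]

lemma padicUnitPart_coe (a : ℚ_[p]ˣ) : ((padicUnitPart a : ℤ_[p]) : ℚ_[p]) =
    a * (p : ℚ_[p]) ^ (-(a : ℚ_[p]).valuation) := rfl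

/-- An orthogonal complement argument for lattices: the reduction of a metabolic form over `ℚ_[p]`
is metabolic. -/
lemma halfIsotropic_reduction {ι : Type} [Fintype ι] (d : ι → Prop) [DecidablePred d]
    (u : ι → ℤ_[p]ˣ) (c : ι → ℚ_[p]ˣ)
    (hc : ∀ i, (p : ℚ_[p]) * c i = if d i then ((u i : ℤ_[p]) : ℚ_[p]) else
      (p : ℚ_[p]) * ((u i : ℤ_[p]) : ℚ_[p]))
    (h : HalfIsotropic (diagForm c)) :
    HalfIsotropic (diagForm fun i : {i // d i} =>
      Units.map (PadicInt.toZMod (p := p) : ℤ_[p] →* ZMod p) (u i)) := by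
  classical
  have hp0 : (p : ℚ_[p]) ≠ 0 := by exact_mod_cast (Fact.out : p.Prime).ne_zero
  obtain ⟨N, hN⟩ := (diagForm_halfIsotropic_iff c).mp h
  let co : (ι → ℤ_[p]) → (ι → ℚ_[p]) := fun y i => (y i : ℚ_[p])
  -- the integral coefficients of `p` times the form
  let k : ι → ℤ_[p] := fun i => if d i then (u i : ℤ_[p]) else p * u i
  have hk : ∀ i, (k i : ℚ_[p]) = p * c i := fun i => by
    rw [hc]; simp only [k]; split_ifs <;> simp
  have hpB : ∀ y w : ι → ℤ_[p], (p : ℚ_[p]) * diagForm c (co y) (co w) =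
      ((∑ i, k i * (y i * w i) : ℤ_[p]) : ℚ_[p]) := fun y w => by
    rw [diagForm_apply, Finset.mul_sum, PadicInt.coe_sum]
    refine Finset.sum_congr rfl fun i _ => ?_
    rw [PadicInt.coe_mul, hk, PadicInt.coe_mul]; simp only [co]; ring
  have hred : ∀ y w : ι → ℤ_[p], PadicInt.toZMod (∑ i, k i * (y i * w i)) =
      diagForm (fun i : {i // d i} =>
        Units.map (PadicInt.toZMod (p := p) : ℤ_[p] →* ZMod p) (u i))
        (fun i => PadicInt.toZMod (y i)) (fun i => PadicInt.toZMod (w i)) := fun y w => by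
    rw [diagForm_apply, map_sum]
    refine Eq.trans ?_ (Finset.sum_subtype (Finset.univ.filter d) (by simp)
      (fun i => PadicInt.toZMod (u i : ℤ_[p]) * (PadicInt.toZMod (y i) * PadicInt.toZMod (w i))))
    rw [Finset.sum_filter]
    refine Finset.sum_congr rfl fun i _ => ?_
    simp only [k]
    split_ifs <;> simp
  let P : Submodule ℤ_[p] (ι → ℤ_[p]) :=
    { carrier := {y | co y ∈ N}
      add_mem' := fun {y w} hy hw => by
        have : co (y + w) = co y + co w := by ext i; simp [co]
        simpa [this] using N.add_mem hy hw
      zero_mem' := by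
        have : co 0 = 0 := by ext i; simp [co]
        simp [this]
      smul_mem' := fun r y hy => by
        have : co (r • y) = (r : ℚ_[p]) • co y := by ext i; simp [co]
        simpa [this] using N.smul_mem _ hy }
  have hP : ∀ y, y ∈ P ↔ co y ∈ N := fun y => Iff.rfl
  -- `P` is a direct summand
  have htf : Module.IsTorsionFree ℤ_[p] ((ι → ℤ_[p]) ⧸ P) := by
    refine ⟨fun r hr => ?_⟩
    have hr0 : (r : ℚ_[p]) ≠ 0 := by simpa using hr.ne_zero
    rw [isSMulRegular_iff_right_eq_zero_of_smul]
    intro q hq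
    obtain ⟨y, rfl⟩ := P.mkQ_surjective q
    rw [← map_smul, Submodule.mkQ_apply, Submodule.Quotient.mk_eq_zero, hP] at hq
    rw [Submodule.mkQ_apply, Submodule.Quotient.mk_eq_zero, hP]
    have : co (r • y) = (r : ℚ_[p]) • co y := by ext i; simp [co]
    rw [this] at hq
    exact (N.smul_mem_iff hr0).mp hq
  have : Module.Free ℤ_[p] ((ι → ℤ_[p]) ⧸ P) := Module.free_of_finite_type_torsion_free'
  obtain ⟨s, hs⟩ := P.mkQ.exists_rightInverse_of_surjective P.range_mkQ
  let π : (ι → ℤ_[p]) →ₗ[ℤ_[p]] (ι → ℤ_[p]) := LinearMap.id - s ∘ₗ P.mkQ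
  have hπ : ∀ y, π y ∈ P := fun y => by
    rw [← Submodule.Quotient.mk_eq_zero, ← Submodule.mkQ_apply]
    have := LinearMap.congr_fun hs (P.mkQ y)
    simp only [LinearMap.comp_apply, LinearMap.id_apply] at this
    simp only [π, LinearMap.sub_apply, LinearMap.id_apply, LinearMap.comp_apply, map_sub, this,
      sub_self]
  have hπ' : ∀ y ∈ P, π y = y := fun y hy => by
    have : P.mkQ y = 0 := by simpa using hy
    simp [π, this]
  -- orthogonality to `P` is orthogonality to `N`
  have hden : ∀ z : ι → ℚ_[p], (∀ w ∈ P, diagForm c (co w) z = 0) → z ∈ N := fun z hz => by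
    rw [hN]
    intro w hw
    obtain ⟨b, hb⟩ := IsLocalization.exist_integer_multiples_of_finite (nonZeroDivisors ℤ_[p]) w
    choose y hy using hb
    have hy' : co y = ((b : ℤ_[p]) : ℚ_[p]) • w := by
      ext i
      have := hy i
      rw [PadicInt.algebraMap_apply] at this
      simp only [co, this, Pi.smul_apply, smul_eq_mul]
      rfl
    have h1 := hz y (by rw [hP, hy']; exact N.smul_mem _ hw)
    rw [hy', map_smul, LinearMap.smul_apply, smul_eq_mul, mul_eq_zero] at h1
    exact h1.resolve_left fun h0 => nonZeroDivisors.ne_zero b.2 (PadicInt.coe_eq_zero.mp h0)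
  rw [diagForm_halfIsotropic_iff]
  have hsurj : Function.Surjective (PadicInt.toZMod (p := p)) :=
    ZMod.ringHom_surjective _
  refine ⟨{ carrier := {m | ∃ y ∈ P, (fun i : {i // d i} => PadicInt.toZMod (y i)) = m}
            add_mem' := ?_, zero_mem' := ?_, smul_mem' := ?_ }, fun m => ⟨?_, fun hm => ?_⟩⟩
  · rintro _ _ ⟨y, hy, rfl⟩ ⟨w, hw, rfl⟩
    exact ⟨y + w, P.add_mem hy hw, by ext i; simp⟩
  · exact ⟨0, P.zero_mem, by ext i; simp⟩
  · rintro r _ ⟨y, hy, rfl⟩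
    obtain ⟨r, rfl⟩ := hsurj r
    exact ⟨r • y, P.smul_mem r hy, by ext i; simp⟩
  · rintro ⟨y, hy, rfl⟩ _ ⟨w, hw, rfl⟩
    have h0 := hpB w y
    rw [(hN _).mp hy _ hw, mul_zero] at h0
    rw [← hred, PadicInt.coe_eq_zero.mp h0.symm, map_zero]
  · have hsurj' := hsurj
    choose f hf using hsurj'
    let z : ι → ℤ_[p] := fun i => if h : d i then f (m ⟨i, h⟩) else 0
    have hz : (fun i : {i // d i} => PadicInt.toZMod (z i)) = m := by
      ext i; simp [z, i.2, hf]
    have hint : ∀ w ∈ P, ∃ r : ℤ_[p], (r : ℚ_[p]) = diagForm c (co w) (co z) := fun w hw => by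
      have h0 := hm _ ⟨w, hw, rfl⟩
      rw [← hz, ← hred, toZMod_eq_zero_iff] at h0
      obtain ⟨r, hr⟩ := h0
      refine ⟨r, mul_left_cancel₀ hp0 ?_⟩
      rw [hpB, hr]; simp
    choose g hg using fun i => hint (π (Pi.single i 1)) (hπ _)
    have hexp : ∀ w ∈ P, diagForm c (co w) (co z) = ∑ i, (g i : ℚ_[p]) * w i := fun w hw => by
      have h1 : w = ∑ i, w i • π (Pi.single i 1) := by
        conv_lhs => rw [← hπ' w hw, pi_eq_sum_univ' w, map_sum]
        exact Finset.sum_congr rfl fun i _ => by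
          rw [map_smul]
      have h2 : co w = ∑ i, (w i : ℚ_[p]) • co (π (Pi.single i 1)) := by
        ext j
        have := congrFun h1 j
        rw [Finset.sum_apply] at this ⊢
        simp only [co]
        rw [this, PadicInt.coe_sum]
        simp
      rw [h2, map_sum, LinearMap.sum_apply]
      refine Finset.sum_congr rfl fun i _ => ?_
      rw [map_smul, LinearMap.smul_apply, ← hg, smul_eq_mul, mul_comm]
    let z' : ι → ℤ_[p] := fun i => (if d i then (p : ℤ_[p]) else 1) * ((u i)⁻¹ : ℤ_[p]ˣ) * g i
    have hz' : ∀ i, (c i : ℚ_[p]) * z' i = g i := fun i => by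
      have h1 : k i * z' i = (p : ℤ_[p]) * g i := by
        simp only [k, z']
        split_ifs <;> linear_combination (p : ℤ_[p]) * g i * (u i).mul_inv
      refine mul_left_cancel₀ hp0 ?_
      rw [← mul_assoc, ← hk, ← PadicInt.coe_mul, h1]
      simp
    have hmem : z - z' ∈ P := by
      rw [hP]
      refine hden _ fun w hw => ?_
      have : co (z - z') = co z - co z' := by ext i; simp [co]
      rw [this, map_sub, hexp w hw, diagForm_apply, sub_eq_zero]
      refine Finset.sum_congr rfl fun i _ => ?_
      rw [← hz']; simp only [co]; ring
    refine ⟨z - z', hmem, ?_⟩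
    rw [← hz]
    ext i
    simp [z', i.2]

/-- The second residue of `[a]` with respect to the uniformizer `p`: for `a = u * p ^ v` with a unit
`u`, it is `0` if `v` is even and the class of `u` modulo `p` if `v` is odd. -/
def padicResidueUnit (a : ℚ_[p]ˣ) : WittGroup (ZMod p) :=
  open Classical in
  if Odd (a : ℚ_[p]).valuation then
    WittGroup.unit (Units.map (PadicInt.toZMod (p := p) : ℤ_[p] →* ZMod p) (padicUnitPart a))
  else 0

lemma padicResidueUnit_killsMetabolic :
    WittGroup.KillsMetabolic (padicResidueUnit (p := p)) := by
  classical
  intro ι _ a h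
  have hp0 : (p : ℚ_[p]) ≠ 0 := by exact_mod_cast (Fact.out : p.Prime).ne_zero
  let d : ι → Prop := fun i => Odd (a i : ℚ_[p]).valuation
  let t : ι → ℚ_[p]ˣ := fun i => Units.mk0 (p : ℚ_[p]) hp0 ^ (((a i : ℚ_[p]).valuation + 1) / 2)
  let c : ι → ℚ_[p]ˣ := fun i => a i * (t i)⁻¹ ^ 2
  have hc : ∀ i, (p : ℚ_[p]) * c i = if d i then ((padicUnitPart (a i) : ℤ_[p]) : ℚ_[p]) else
      (p : ℚ_[p]) * ((padicUnitPart (a i) : ℤ_[p]) : ℚ_[p]) := fun i => by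
    simp only [padicUnitPart_coe, d, c, t]
    push_cast
    rw [Units.val_mk0, ← zpow_neg, ← zpow_natCast, ← zpow_mul]
    split_ifs with ho
    · obtain ⟨r, hr⟩ := ho
      rw [hr, show (2 * r + 1 + 1) / 2 = r + 1 by omega, mul_left_comm, ← zpow_one_add₀ hp0]
      congr 2; push_cast; ring
    · obtain ⟨r, hr⟩ := Int.not_odd_iff_even.mp ho
      rw [hr, show (r + r + 1) / 2 = r by omega]
      congr 3; push_cast; ring
  have h1 : HalfIsotropic (diagForm c) := by
    have h' : HalfIsotropic (diagForm a) := h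
    refine h'.congr
      (LinearEquiv.piCongrRight fun i => LinearEquiv.smulOfUnit (t i)) fun x y => ?_
    rw [diagForm_apply, diagForm_apply]
    refine Finset.sum_congr rfl fun i _ => ?_
    have : ((t i)⁻¹ : ℚ_[p]ˣ).val * (t i).val = 1 := (t i).inv_mul
    change ((c i : ℚ_[p]ˣ) : ℚ_[p]) * ((t i : ℚ_[p]) * x i * ((t i : ℚ_[p]) * y i)) = _
    simp only [c, Units.val_mul, Units.val_pow_eq_pow_val]
    linear_combination (a i : ℚ_[p]) * x i * y i * (((t i)⁻¹ : ℚ_[p]ˣ).val * (t i).val + 1) * this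
  have h2 := WittGroup.mk_eq_zero (A := SymForm.diag _)
    (halfIsotropic_reduction d (fun i => padicUnitPart (a i)) c hc h1)
  rw [SymForm.mk_diag] at h2
  rw [← h2, ← Finset.sum_subtype (Finset.univ.filter d) (by simp)
      (fun i => WittGroup.unit (Units.map (PadicInt.toZMod (p := p) : ℤ_[p] →* ZMod p)
        (padicUnitPart (a i)))), Finset.sum_filter]
  rfl

end Padic

namespace WittGroup

variable (p : ℕ) [Fact p.Prime]

/-- The second residue homomorphism `W(ℚ_p) → W(𝔽_p)` for the uniformizer `p`. -/
def padicResidue : WittGroup ℚ_[p] →+ WittGroup (ZMod p) :=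
  lift two_ne_zero padicResidueUnit padicResidueUnit_killsMetabolic

/-- The homomorphism `∂_p : W(ℚ) → W(𝔽_p)`. -/
def residue : WittGroup ℚ →+ WittGroup (ZMod p) :=
  (padicResidue p).comp (baseChange ℚ_[p])

end WittGroup

instance fact_prime_primes (q : Nat.Primes) : Fact (q : ℕ).Prime := ⟨q.2⟩

namespace WittGroup

/-- The homomorphism `∂ = (∂_q)_q` to the Witt groups of all prime fields. Its values have finite
support, so equality in the product is equality in the direct sum. -/
def boundary : WittGroup ℚ →+ ((q : Nat.Primes) → WittGroup (ZMod q)) :=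
  AddMonoidHom.mk' (fun w q => residue q w) fun _ _ => funext fun _ => map_add _ _ _

/-- The Witt span of a class `w`: the least rank of a form `B` with `∂ [B] = ∂ w`. -/
def wittSpan (w : WittGroup ℚ) : ℕ :=
  sInf {n | ∃ B : SymForm ℚ, B.rank = n ∧ boundary (mk B) = boundary w}

end WittGroup

/-! Singular homology in degree one. -/

section Homology

variable (X : Type) [TopologicalSpace X]

/-- The edge `t ↦ (1 - t) eᵢ + t eⱼ` of the standard 2-simplex. -/
def simplexEdge (i j : Fin 3) : C(unitInterval, stdSimplex ℝ (Fin 3)) where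
  toFun t := ⟨(1 - (t : ℝ)) • Pi.single i 1 + (t : ℝ) • Pi.single j 1,
    convex_stdSimplex ℝ (Fin 3) (single_mem_stdSimplex ℝ i) (single_mem_stdSimplex ℝ j)
      (sub_nonneg.mpr t.2.2) t.2.1 (by ring)⟩
  continuous_toFun := by fun_prop

/-- The boundary map from singular 1-chains to singular 0-chains. -/
def singularBoundary₁ : (C(unitInterval, X) →₀ ℤ) →ₗ[ℤ] (X →₀ ℤ) :=
  Finsupp.linearCombination ℤ fun σ => Finsupp.single (σ 1) 1 - Finsupp.single (σ 0) 1

/-- The boundary map from singular 2-chains to singular 1-chains. -/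
def singularBoundary₂ : (C(stdSimplex ℝ (Fin 3), X) →₀ ℤ) →ₗ[ℤ] (C(unitInterval, X) →₀ ℤ) :=
  Finsupp.linearCombination ℤ fun τ =>
    Finsupp.single (τ.comp (simplexEdge 1 2)) 1 - Finsupp.single (τ.comp (simplexEdge 0 2)) 1 +
      Finsupp.single (τ.comp (simplexEdge 0 1)) 1

/-- The first singular homology group `H₁(X; ℤ)`. -/
abbrev SingularH₁ : Type :=
  LinearMap.ker (singularBoundary₁ X) ⧸
    (LinearMap.range (singularBoundary₂ X)).submoduleOf (LinearMap.ker (singularBoundary₁ X))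

variable {X}

/-- The homology class of a loop. -/
def loopClass (σ : C(unitInterval, X)) (h : σ 0 = σ 1) : SingularH₁ X :=
  Submodule.Quotient.mk ⟨Finsupp.single σ 1, by simp [singularBoundary₁, h]⟩

end Homology

/-! Knots, Seifert surfaces and the Witt class. -/

open scoped ContDiff

/-- Euclidean 3-space. -/
abbrev E3 : Type := EuclideanSpace ℝ (Fin 3)

/-- A knot: a smoothly embedded circle, parametrized with period `1`. -/
structure Knot where
  toFun : ℝ → E3
  smooth : ContDiff ℝ ∞ toFun
  periodic : Function.Periodic toFun 1
  injOn : Set.InjOn toFun (Set.Ico 0 1)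
  immersed : ∀ t, deriv toFun t ≠ 0

/-- The underlying set of a knot. -/
def Knot.image (K : Knot) : Set E3 := Set.range K.toFun

/-- A diffeomorphism between open subsets of 3-space. -/
def IsSmoothChart (φ : OpenPartialHomeomorph E3 E3) : Prop :=
  ContDiffOn ℝ ∞ φ φ.source ∧ ContDiffOn ℝ ∞ φ.symm φ.target

/-- A Seifert surface of `K`: a compact connected smooth surface embedded in 3-space, with boundary
`K`, oriented by a continuous field of unit normal vectors. Near a point off `K` the surface is
straightened to the plane `x₂ = 0`, near a point of `K` to the half-plane `x₂ = 0 ≤ x₁`, with `K`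
going to the edge of the half-plane. Which of the two orientations is taken does not matter for the
symmetrized Seifert form, so none is singled out by `K`. -/
structure SeifertSurface (K : Knot) where
  carrier : Set E3
  isCompact : IsCompact carrier
  isConnected : IsConnected carrier
  boundary_subset : K.image ⊆ carrier
  normal : E3 → E3
  continuousOn_normal : ContinuousOn normal carrier
  norm_normal : ∀ x ∈ carrier, ‖normal x‖ = 1
  exists_chart : ∀ x ∈ carrier, ∃ φ : OpenPartialHomeomorph E3 E3, IsSmoothChart φ ∧ x ∈ φ.source ∧
    (∀ v : E3, (fderiv ℝ φ x v) 2 = 0 → inner ℝ (normal x) v = 0) ∧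
    ((x ∉ K.image ∧ ∀ y ∈ φ.source, y ∈ carrier ↔ φ y 2 = 0) ∨
      (x ∈ K.image ∧ ∀ y ∈ φ.source, (y ∈ carrier ↔ φ y 2 = 0 ∧ 0 ≤ φ y 1) ∧
        (y ∈ K.image ↔ φ y 2 = 0 ∧ φ y 1 = 0)))

/-- Gauss's integral for the linking number of two disjoint smooth closed curves of period `1`. -/
def linkingNumber (a c : ℝ → E3) : ℝ :=
  (4 * Real.pi)⁻¹ * ∫ s in (0 : ℝ)..1, ∫ t in (0 : ℝ)..1,
    Matrix.det (Matrix.of fun i j : Fin 3 => (![a s - c t, deriv a s, deriv c t] i) j) /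
      ‖a s - c t‖ ^ 3

/-- A smooth closed curve, of period `1`, on a subset of 3-space. -/
structure SmoothLoop (S : Set E3) where
  toFun : ℝ → E3
  smooth : ContDiff ℝ ∞ toFun
  periodic : Function.Periodic toFun 1
  mem : ∀ t, toFun t ∈ S

namespace SmoothLoop

variable {S : Set E3} (a : SmoothLoop S)

/-- The loop as a singular 1-simplex. -/
def toSimplex : C(unitInterval, S) where
  toFun t := ⟨a.toFun t, a.mem t⟩
  continuous_toFun := by
    have := a.smooth.continuous
    fun_prop

/-- The homology class of the loop. -/
def homologyClass : SingularH₁ S :=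
  loopClass a.toSimplex <| Subtype.ext <| by
    simpa [toSimplex] using (a.periodic 0).symm

end SmoothLoop

namespace SeifertSurface

variable {K : Knot} (S : SeifertSurface K)

/-- The push-off of a curve on the surface by `ε` in the positive normal direction. -/
def pushOff (ε : ℝ) (b : SmoothLoop S.carrier) : ℝ → E3 :=
  fun t => b.toFun t + ε • S.normal (b.toFun t)

/-- `V` is the Seifert form of the surface: `V(α, β) = lk(a, b⁺)` for curves `a`, `b` on the surface
that represent `α`, `β` and a small positive push-off `b⁺` of `b`. As curves generate the homology
group, this determines `V`. -/
def IsSeifertForm (V : LinearMap.BilinForm ℤ (SingularH₁ S.carrier)) : Prop :=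
  ∀ a b : SmoothLoop S.carrier, ∀ᶠ ε in nhdsWithin (0 : ℝ) (Set.Ioi 0),
    (V a.homologyClass b.homologyClass : ℝ) = linkingNumber a.toFun (S.pushOff ε b)

end SeifertSurface

/-- `w` is the Witt class of `K`: for a Seifert surface `S` of `K` with Seifert form `V`, it is the
class of the extension of `V + Vᵀ` to `ℚ ⊗ H₁(S; ℤ) = H₁(S; ℚ)`. -/
def Knot.IsWittClass (K : Knot) (w : WittGroup ℚ) : Prop :=
  ∃ (S : SeifertSurface K) (V : LinearMap.BilinForm ℤ (SingularH₁ S.carrier)) (A : SymForm ℚ)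
    (e : A.V ≃ₗ[ℚ] ℚ ⊗[ℤ] SingularH₁ S.carrier),
    S.IsSeifertForm V ∧ (∀ x y, (V + V.flip).baseChange ℚ (e x) (e y) = A.B x y) ∧
      w = WittGroup.mk A

end

/-! A form over `ℚ` is diagonal, so its residues can be read off its rank one summands: `⟨a⟩`
contributes at `q` exactly when the valuation of `a` at `q` is odd (`residue_unit`). The rank of the
residue modulo two is therefore the parity of the valuation of the determinant
(`rankParity_residue_unit`), and a rational with even valuation at all primes is a square up to sign
(`Rat.exists_sq_of_even_padicValRat`). Residues thus determine the determinant up to sign and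
squares. At `p ≡ 1 mod 4` the sign is invisible, since `-1` is a square and `[u] + [u] = 0`.

Lower bounds. A form `⟨a⟩` unramified outside `p` has `a = ±1` or `±p` up to squares, so its residue
at `p` is `0` or `[1]`, never `[β]`. If the residue at `p` is `[1] + [β]`, all residues have even
rank. A rank one form with this property has even valuations, and a rank two form `⟨a⟩ ⊕ ⟨b⟩` has
`[a] = ±[b]`; either way the residue at `p` vanishes, while `[1] + [β] ≠ 0`.

Upper bounds. Dirichlet's theorem gives a prime `r ≡ 3 mod 4` with `r ≡ β mod p`, and quadratic
reciprocity shows that `⟨pr⟩ ⊕ ⟨r⟩` has residue `[β]` at `p` and none elsewhere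
(`exists_residue_eq_unit`). Adding `⟨p⟩` gives `[1] + [β]`. -/

noncomputable section

open Module TensorProduct

/-! ### Lagrangians and Witt cancellation. -/

namespace SymForm

variable {F : Type} [Field F]

lemma nondegenerate (A : SymForm F) : A.B.Nondegenerate :=
  (LinearMap.IsRefl.nondegenerate_iff_separatingLeft
    (fun x y hxy => by rw [A.symm, hxy])).mpr A.nondeg

lemma orthogonal_eq_of_isotropic (A : SymForm F) {N : Submodule F A.V}
    (hN : ∀ x ∈ N, ∀ y ∈ N, A.B x y = 0) (hd : finrank F A.V = 2 * finrank F N) :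
    A.B.orthogonal N = N := by
  have hle : N ≤ A.B.orthogonal N := fun z hz w hw => hN w hw z hz
  refine (Submodule.eq_of_le_of_finrank_eq hle ?_).symm
  rw [LinearMap.BilinForm.finrank_orthogonal A.nondegenerate, hd]
  omega

/-- Cancellation of a metabolic summand. -/
lemma Metabolic.of_oplus {A M : SymForm F} (h : (A.oplus M).Metabolic) (hM : M.Metabolic) :
    A.Metabolic := by
  obtain ⟨L, hL, hLd⟩ := h
  obtain ⟨N, hN, hNd⟩ := hM
  have hLo := (A.oplus M).orthogonal_eq_of_isotropic hL hLd
  have hNo := M.orthogonal_eq_of_isotropic hN hNd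
  let N₀ : Submodule F (A.oplus M).V := N.map (LinearMap.inr F A.V M.V)
  have hN₀ : finrank F N₀ = finrank F N :=
    (Submodule.equivMapOfInjective _ LinearMap.inr_injective N).finrank_eq.symm
  -- Since `L` and `N` are their own orthogonals, `P` consists of the elements of `L` with second
  -- component in `N`. Its projection to `A` is isotropic because the `M`-part of the form vanishes
  -- on `N`.
  let P := (A.oplus M).B.orthogonal (L ⊔ N₀)
  have hPL : ∀ x ∈ P, x ∈ L := fun x hx => by
    rw [← hLo]
    exact fun w hw => hx w (Submodule.mem_sup_left hw)
  have hPN : ∀ x : A.V × M.V, x ∈ P → x.2 ∈ N := fun x hx => by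
    rw [← hNo]
    intro w hw
    have : (A.oplus M).B ((0, w) : A.V × M.V) x = 0 :=
      hx _ (Submodule.mem_sup_right ⟨w, hw, rfl⟩)
    rw [oplus_apply] at this
    simpa using this
  let f : P →ₗ[F] A.V := (LinearMap.fst F A.V M.V).domRestrict P
  have hiso : ∀ x ∈ LinearMap.range f, ∀ y ∈ LinearMap.range f, A.B x y = 0 := by
    rintro _ ⟨x, rfl⟩ _ ⟨y, rfl⟩
    have h1 : A.B (f x) (f y) + M.B (x.1 : A.V × M.V).2 (y.1 : A.V × M.V).2 = 0 :=
      hL _ (hPL _ x.2) _ (hPL _ y.2)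
    rwa [hN _ (hPN _ x.2) _ (hPN _ y.2), add_zero] at h1
  -- With this bound, `dim (L + N₀) + dim (L ∩ N₀) = dim L + dim N` makes the projection at least
  -- half-dimensional. Isotropy in `A` gives the opposite inequality in `h5`.
  have hker : finrank F (LinearMap.ker f) ≤ finrank F (L ⊓ N₀ : Submodule F (A.oplus M).V) := by
    rw [← Submodule.finrank_map_subtype_eq]
    refine Submodule.finrank_mono ?_
    rintro _ ⟨x, hx, rfl⟩
    refine ⟨hPL _ x.2, (x.1 : A.V × M.V).2, hPN _ x.2, ?_⟩
    exact Prod.ext (LinearMap.mem_ker.mp hx).symm rfl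
  have h1 := LinearMap.finrank_range_add_finrank_ker f
  have h2 : finrank F P = _ :=
    LinearMap.BilinForm.finrank_orthogonal (A.oplus M).nondegenerate (L ⊔ N₀)
  have h3 := Submodule.finrank_sup_add_finrank_inf_eq L N₀
  have h4 : finrank F (A.oplus M).V = finrank F A.V + finrank F M.V := Module.finrank_prod
  have h5 : finrank F (LinearMap.range f) ≤ finrank F (A.B.orthogonal (LinearMap.range f)) :=
    Submodule.finrank_mono fun z hz w hw => hiso w hw z hz
  rw [LinearMap.BilinForm.finrank_orthogonal A.nondegenerate] at h5
  have h6 := Submodule.finrank_le (LinearMap.range f)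
  exact ⟨_, hiso, by omega⟩

end SymForm

/-! ### Classes of rank one forms, rank parity and residues. -/

namespace WittGroup

variable {F : Type} [Field F]

/-- By definition, vanishing only says that the form is stably metabolic; cancellation removes the
stabilization. This is what allows Witt classes to be proved non-zero. -/
lemma mk_eq_zero_iff {A : SymForm F} : mk A = 0 ↔ A.Metabolic := by
  refine ⟨fun h => ?_, mk_eq_zero⟩
  obtain ⟨M, N, hM, hN, h⟩ : A.WittEquiv (SymForm.zero F) := Quotient.exact h
  exact ((SymForm.metabolic_zero.oplus hN).of_isometric h.symm).of_oplus hM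

lemma unit_neg (a : Fˣ) : unit (-a) = -unit a := by
  rw [unit, unit, ← mk_neg]
  refine mk_eq_of_isometric ⟨LinearEquiv.refl F F, fun (x y : F) => ?_⟩
  change -((a : F) * (x * y)) = ((-a : Fˣ) : F) * (x * y)
  simp

/-- A Lagrangian of a binary form is a line. An isotropic `(x, y) ≠ 0` has `y ≠ 0`, and `a x² + b y²
= 0` gives `(a x / y)² = -ab`. -/
lemma unit_add_unit_eq_zero_iff (a b : Fˣ) :
    unit a + unit b = 0 ↔ IsSquare (-(a * b) : F) := by
  have hrank : finrank F ((SymForm.rankOne a).oplus (SymForm.rankOne b)).V = 2 := by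
    change finrank F (F × F) = 2
    simp
  rw [unit, unit, ← mk_oplus, mk_eq_zero_iff]
  constructor
  · rintro ⟨N, hN, hd⟩
    have hN1 : N ≠ ⊥ := by
      rintro rfl
      rw [hrank, finrank_bot] at hd
      omega
    obtain ⟨v, hv, hv0⟩ := N.exists_mem_ne_zero_of_ne_bot hN1
    obtain ⟨x, y⟩ : F × F := v
    have h : (a : F) * (x * x) + b * (y * y) = 0 := hN _ hv _ hv
    have hy : y ≠ 0 := by
      rintro rfl
      have hx : x = 0 := by simpa using h
      exact hv0 (Prod.ext hx rfl)
    refine ⟨a * x / y, ?_⟩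
    field_simp
    linear_combination -h
  · rintro ⟨c, hc⟩
    -- The vector `(b, c)` is isotropic: `a b² + b c² = b (a b + c²) = 0`.
    have hv : ((b, c) : F × F) ≠ 0 := fun h => b.ne_zero (Prod.ext_iff.mp h).1
    refine ⟨F ∙ ((b, c) : F × F), ?_, ?_⟩
    · intro x hx y hy
      obtain ⟨r, rfl⟩ := Submodule.mem_span_singleton.mp hx
      obtain ⟨s, rfl⟩ := Submodule.mem_span_singleton.mp hy
      change (a : F) * ((r * b) * (s * b)) + b * ((r * c) * (s * c)) = 0
      linear_combination (-(r * s * b) : F) * hc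
    · exact hrank.trans (by
        have h1 : finrank F (F ∙ ((b, c) : F × F)) = 1 := finrank_span_singleton hv
        exact (congrArg (2 * ·) h1).symm)

lemma unit_eq_unit_iff (a b : Fˣ) : unit a = unit b ↔ IsSquare (a * b : F) := by
  rw [← sub_eq_zero, sub_eq_add_neg, ← unit_neg, unit_add_unit_eq_zero_iff]
  simp

/-- The rank modulo two. -/
def rankParity (F : Type) [Field F] : WittGroup F →+ ZMod 2 :=
  AddMonoidHom.mk' (Quotient.lift (fun A : SymForm F => (A.rank : ZMod 2)) <| by
    -- Metabolic forms have even rank, so stabilization preserves the parity, in characteristic two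
    -- as well.
    rintro A B ⟨M, N, ⟨_, _, hM⟩, ⟨_, _, hN⟩, ⟨e, _⟩⟩
    have h : finrank F (A.V × M.V) = finrank F (B.V × N.V) := e.finrank_eq
    rw [Module.finrank_prod, Module.finrank_prod, hM, hN] at h
    have h' := congrArg (Nat.cast : ℕ → ZMod 2) h
    have h2 : (2 : ZMod 2) = 0 := rfl
    simpa [h2, SymForm.rank] using h') <| by
  rintro ⟨A⟩ ⟨B⟩
  change ((finrank F (A.V × B.V) : ℕ) : ZMod 2) = (finrank F A.V : ℕ) + (finrank F B.V : ℕ)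
  rw [Module.finrank_prod, Nat.cast_add]

@[simp] lemma rankParity_unit (a : Fˣ) : rankParity F (unit a) = 1 := by
  change ((finrank F F : ℕ) : ZMod 2) = 1
  simp

lemma mk_eq_sum_unit (h2 : (2 : F) ≠ 0) (A : SymForm F) :
    ∃ a : Fin A.rank → Fˣ, mk A = ∑ i, unit (a i) := by
  obtain ⟨a, ha⟩ := A.exists_diag h2
  exact ⟨a, (mk_eq_of_isometric ha).trans (SymForm.mk_diag a)⟩

lemma baseChange_unit (L : Type) [Field L] [Algebra F L] (a : Fˣ) :
    baseChange L (unit a) = unit (Units.map (algebraMap F L : F →* L) a) := by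
  refine mk_eq_of_isometric ⟨TensorProduct.AlgebraTensorModule.rid F L L,
    fun (x y : L ⊗[F] F) => ?_⟩
  change algebraMap F L a * (TensorProduct.AlgebraTensorModule.rid F L L x *
    TensorProduct.AlgebraTensorModule.rid F L L y) =
    LinearMap.BilinForm.baseChange L ((a : F) • LinearMap.mul F F) x y
  induction x using TensorProduct.induction_on with
  | zero => simp
  | add x x' hx hx' => simp [hx, hx', add_mul, mul_add]
  | tmul l n =>
    induction y using TensorProduct.induction_on with
    | zero => simp
    | add y y' hy hy' => rw [map_add, map_add, mul_add, mul_add, hy, hy']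
    | tmul l' n' => simp [Algebra.smul_def]; ring

variable (p : ℕ) [Fact p.Prime]

lemma residue_unit (a : ℚˣ) : residue p (unit a) =
    padicResidueUnit (Units.map (algebraMap ℚ ℚ_[p] : ℚ →* ℚ_[p]) a) := by
  rw [residue, AddMonoidHom.comp_apply, baseChange_unit, padicResidue, lift_unit]

lemma residue_unit_of_even {a : ℚˣ} (h : Even (padicValRat p a)) : residue p (unit a) = 0 := by
  rw [residue_unit, padicResidueUnit, if_neg]
  simpa using h

lemma exists_residue_unit_of_odd {a : ℚˣ} (h : Odd (padicValRat p a)) :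
    ∃ u : (ZMod p)ˣ, residue p (unit a) = unit u := by
  rw [residue_unit, padicResidueUnit, if_pos]
  · exact ⟨_, rfl⟩
  · simpa using h

/-- The residue of `[p * n]` for an integer `n` prime to `p` is the class of `n` modulo `p`. -/
lemma residue_unit_prime_mul (n : ℤ) (u : (ZMod p)ˣ) (hu : (u : ZMod p) = n) (a : ℚˣ)
    (ha : (a : ℚ) = p * n) : residue p (unit a) = unit u := by
  have hp0 : (p : ℚ_[p]) ≠ 0 := by exact_mod_cast (Fact.out : p.Prime).ne_zero
  have hn : ¬ (p : ℤ) ∣ n := fun h =>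
    u.ne_zero (hu.trans ((ZMod.intCast_zmod_eq_zero_iff_dvd _ _).mpr h))
  have hn0 : n ≠ 0 := by rintro rfl; simp at hn
  have hv : padicValRat p a = 1 := by
    rw [ha, padicValRat.mul (by exact_mod_cast (Fact.out : p.Prime).ne_zero)
      (by exact_mod_cast hn0), padicValRat.self (Fact.out : p.Prime).one_lt, padicValRat.of_int,
      padicValInt.eq_zero_of_not_dvd hn]
    simp
  have hv' : ((Units.map (algebraMap ℚ ℚ_[p] : ℚ →* ℚ_[p]) a : ℚ_[p]ˣ) : ℚ_[p]).valuation = 1 := by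
    rw [← hv]; simp
  rw [residue_unit, padicResidueUnit, if_pos (by rw [hv']; exact odd_one)]
  congr 1
  ext
  rw [hu, Units.coe_map]
  have : (padicUnitPart (Units.map (algebraMap ℚ ℚ_[p] : ℚ →* ℚ_[p]) a) : ℤ_[p]) = n := by
    apply Subtype.ext
    rw [padicUnitPart_coe, hv']
    simp [ha]
    field_simp
  rw [this]
  simp

/-- The unit part affects only which rank one class occurs, not the rank. Summed over a diagonal
form, this yields the valuation of the determinant modulo two. -/
lemma rankParity_residue_unit (a : ℚˣ) :
    rankParity _ (residue p (unit a)) = (padicValRat p a : ZMod 2) := by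
  rcases Int.even_or_odd (padicValRat p a) with h | h
  · rw [residue_unit_of_even p h, map_zero]
    exact (ZMod.intCast_eq_zero_iff_even.mpr h).symm
  · obtain ⟨u, hu⟩ := exists_residue_unit_of_odd p h
    rw [hu, rankParity_unit]
    exact (ZMod.intCast_eq_one_iff_odd.mpr h).symm

end WittGroup

/-! ### Arithmetic: squares in `ℚ`, primes in progressions, squares modulo `p`. -/

lemma Rat.exists_sq_of_even_padicValRat {a : ℚ} (ha : a ≠ 0)
    (h : ∀ (q : ℕ) [Fact q.Prime], Even (padicValRat q a)) : ∃ c : ℚ, a = c ^ 2 ∨ a = -c ^ 2 := by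
  -- The integer `num * den` equals `a * den²`, so it has the square class of `a`. It remains to see
  -- that its squarefree part `s` is `1`.
  obtain ⟨s, b, hbs, hs⟩ := Nat.sq_mul_squarefree (a.num * a.den).natAbs
  have hden : (a.den : ℚ) ≠ 0 := by exact_mod_cast a.den_ne_zero
  have hab : ((a.num * a.den).natAbs : ℚ) = |a| * a.den ^ 2 := by
    have : a * a.den ^ 2 = a.num * a.den := by
      rw [sq, ← mul_assoc, Rat.mul_den_eq_num]
    rw [Nat.cast_natAbs, Int.cast_abs, Int.cast_mul, Int.cast_natCast, ← this, abs_mul]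
    simp
  rw [← hbs] at hab
  push_cast at hab
  have habs : |a| ≠ 0 := abs_ne_zero.mpr ha
  have hb0 : (b : ℚ) ≠ 0 := by
    intro h0
    rw [h0] at hab
    have := mul_ne_zero habs (pow_ne_zero 2 hden)
    simp [← hab] at this
  have hs0 : (s : ℚ) ≠ 0 := by exact_mod_cast hs.ne_zero
  have hs1 : s = 1 := by
    by_contra hs1
    -- A prime dividing the squarefree `s` divides it exactly once, which makes the valuation of `a`
    -- odd there.
    obtain ⟨q, hq, hqs⟩ := Nat.exists_prime_and_dvd hs1
    have : Fact q.Prime := ⟨hq⟩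
    have h1 := congrArg (padicValRat q) hab
    rw [padicValRat.mul (pow_ne_zero 2 hb0) hs0, padicValRat.mul habs (pow_ne_zero 2 hden),
      padicValRat.pow, padicValRat.pow] at h1
    have h2 : padicValRat q |a| = padicValRat q a := by
      rcases abs_choice a with h | h <;> simp [h]
    have h3 : padicValRat q (s : ℚ) = 1 := by
      rw [padicValRat.of_nat]
      have h4 := hs.natFactorization_le_one q
      have h5 := hq.factorization_pos_of_dvd hs.ne_zero hqs
      rw [Nat.factorization_def s hq] at h4 h5
      omega
    obtain ⟨r, hr⟩ := h q
    rw [h2, h3, hr] at h1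
    push_cast at h1
    omega
  rw [hs1] at hab
  have h6 : |a| = (b / a.den : ℚ) ^ 2 := by
    field_simp
    simpa using hab.symm
  refine ⟨b / a.den, ?_⟩
  rw [← h6]
  rcases abs_choice a with h | h <;> rw [h] <;> simp

namespace ZMod

variable {p : ℕ} [Fact p.Prime]

lemma isSquare_neg_one_of_mod_four_eq_one (hp : p % 4 = 1) : IsSquare (-1 : ZMod p) :=
  ZMod.exists_sq_eq_neg_one_iff.mpr (by omega)

/-- A prime congruent to three modulo four in a given class modulo `p`. -/
lemma exists_prime_mod_four_eq_three (hp : p ≠ 2) (u : (ZMod p)ˣ) :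
    ∃ r : ℕ, r.Prime ∧ r % 4 = 3 ∧ (r : ZMod p) = u := by
  have hpp : p.Prime := Fact.out
  have hcop : Nat.Coprime 4 p := by
    rw [show 4 = 2 ^ 2 from rfl]
    exact Nat.Coprime.pow_left 2 ((Nat.coprime_primes Nat.prime_two hpp).mpr hp.symm)
  -- The two congruences combine into one class modulo `4p`; it is invertible, so Dirichlet's
  -- theorem supplies a prime in it.
  obtain ⟨k, hk4, hkp⟩ := Nat.chineseRemainder hcop 3 (u : ZMod p).val
  have hkp' : (k : ZMod p) = u := by
    rw [(ZMod.natCast_eq_natCast_iff _ _ _).mpr hkp, ZMod.natCast_zmod_val]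
  have hk : k.Coprime (4 * p) := by
    refine Nat.Coprime.mul_right ?_ ?_
    · exact hk4.gcd_eq.trans (by norm_num)
    · exact (ZMod.isUnit_iff_coprime k p).mp (hkp' ▸ u.isUnit)
  have : NeZero (4 * p) := ⟨by have := hpp.pos; omega⟩
  obtain ⟨r, -, hr, hrk⟩ := Nat.forall_exists_prime_gt_and_eq_mod
    ((ZMod.isUnit_iff_coprime k (4 * p)).mpr hk) 0
  have hrk' : r ≡ k [MOD 4 * p] := (ZMod.natCast_eq_natCast_iff _ _ _).mp hrk
  refine ⟨r, hr, (hrk'.of_mul_right p).trans hk4, ?_⟩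
  rw [← hkp']
  exact (ZMod.natCast_eq_natCast_iff _ _ _).mpr (hrk'.of_mul_left 4)

/-- Here `-1` is a non-square, and the product of two non-squares is a square by multiplicativity of
the quadratic character. -/
lemma isSquare_neg_of_not_isSquare (hp : p % 4 = 3) {a : ZMod p} (ha : ¬ IsSquare a) :
    IsSquare (-a) := by
  have h1 : ¬ IsSquare (-1 : ZMod p) := by
    rw [ZMod.exists_sq_eq_neg_one_iff]
    omega
  have ha0 : -a ≠ 0 := by
    rw [neg_ne_zero]
    rintro rfl
    exact ha (IsSquare.zero)
  rw [← quadraticChar_one_iff_isSquare ha0, neg_eq_neg_one_mul, map_mul,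
    quadraticChar_neg_one_iff_not_isSquare.mpr ha, quadraticChar_neg_one_iff_not_isSquare.mpr h1]
  rfl

end ZMod

/-! ### Residues of forms of rank one and two. -/

namespace WittGroup

section Residue

variable {p : ℕ} [Fact p.Prime]

/-- As `-1` is a square, so is `-u²`. Consequently signs do not matter in the residue at `p`. -/
lemma unit_add_self (hp : p % 4 = 1) (u : (ZMod p)ˣ) : unit u + unit u = 0 := by
  rw [unit_add_unit_eq_zero_iff, neg_eq_neg_one_mul]
  exact (ZMod.isSquare_neg_one_of_mod_four_eq_one hp).mul (IsSquare.mul_self _)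

lemma residue_unit_add_self (hp : p % 4 = 1) (a : ℚˣ) :
    residue p (unit a) + residue p (unit a) = 0 := by
  rcases Int.even_or_odd (padicValRat p a) with h | h
  · rw [residue_unit_of_even p h, add_zero]
  · obtain ⟨u, hu⟩ := exists_residue_unit_of_odd p h
    rw [hu, unit_add_self hp]

lemma even_padicValRat_of_residue_eq_zero {a : ℚˣ} (h : residue p (unit a) = 0) :
    Even (padicValRat p a) := by
  rw [← ZMod.intCast_eq_zero_iff_even, ← rankParity_residue_unit, h, map_zero]

lemma residue_unit_natCast_of_not_dvd {n : ℕ} (hn : ¬ p ∣ n) {a : ℚˣ} (ha : (a : ℚ) = n) :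
    residue p (unit a) = 0 := by
  refine residue_unit_of_even p ?_
  rw [ha, padicValRat.of_nat, padicValNat.eq_zero_of_not_dvd hn]
  exact Even.zero

/-- The hypothesis makes `ab` a square up to sign, and the two signs are the two cases. This is the
global input to both lower bounds. -/
lemma unit_eq_or_of_even_padicValRat (a b : ℚˣ)
    (h : ∀ (q : ℕ) [Fact q.Prime], Even (padicValRat q a + padicValRat q b)) :
    unit a = unit b ∨ unit a = -unit b := by
  obtain ⟨c, hc⟩ := Rat.exists_sq_of_even_padicValRat (mul_ne_zero a.ne_zero b.ne_zero)
    fun q _ => by rw [padicValRat.mul a.ne_zero b.ne_zero]; exact h q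
  refine hc.imp (fun hc => ?_) fun hc => ?_
  · rw [unit_eq_unit_iff, hc]
    exact IsSquare.sq c
  · rw [← add_eq_zero_iff_eq_neg, unit_add_unit_eq_zero_iff, hc, neg_neg]
    exact IsSquare.sq c

/-- A rank one form ramified at most at `p` has residue `0` or `[1]` at `p`. -/
lemma residue_unit_eq_zero_or_one (hp : p % 4 = 1) (a : ℚˣ)
    (h : ∀ (q : ℕ) [Fact q.Prime], q ≠ p → residue q (unit a) = 0) :
    residue p (unit a) = 0 ∨ residue p (unit a) = unit 1 := by
  have hpp : p.Prime := Fact.out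
  rcases Int.even_or_odd (padicValRat p a) with hv | hv
  · exact .inl (residue_unit_of_even p hv)
  right
  -- The valuations of `a` and `p` have the same parity at every prime, so `a = ±p` up to squares.
  let b : ℚˣ := Units.mk0 (p : ℚ) (by exact_mod_cast hpp.ne_zero)
  have hb : residue p (unit b) = unit 1 := residue_unit_prime_mul p 1 1 (by simp) b (by simp [b])
  have hab : unit a = unit b ∨ unit a = -unit b := by
    refine unit_eq_or_of_even_padicValRat a b fun q _ => ?_
    by_cases hq : q = p
    · subst hq
      rw [show padicValRat q (b : ℚ) = 1 from padicValRat.self hpp.one_lt]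
      exact hv.add_one
    · refine (even_padicValRat_of_residue_eq_zero (h q hq)).add ?_
      refine even_padicValRat_of_residue_eq_zero (residue_unit_natCast_of_not_dvd (n := p) ?_ rfl)
      exact fun hd => hq ((Nat.prime_dvd_prime_iff_eq Fact.out hpp).mp hd)
  rcases hab with hab | hab
  · rw [hab, hb]
  · rw [hab, map_neg, hb, ← add_eq_zero_iff_neg_eq, unit_add_self hp]

/-- A rank two form all of whose residues have even rank has trivial residue at `p`. -/
lemma residue_unit_add_unit_eq_zero (hp : p % 4 = 1) (a b : ℚˣ)
    (h : ∀ (q : ℕ) [Fact q.Prime], rankParity _ (residue q (unit a + unit b)) = 0) :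
    residue p (unit a + unit b) = 0 := by
  -- The rank parity at `q` is that of the valuation of `ab`, so `ab` is a square up to sign. The
  -- class is then `[b] + [b]`, which dies at `p`, or zero.
  have hab : unit a = unit b ∨ unit a = -unit b := by
    refine unit_eq_or_of_even_padicValRat a b fun q _ => ?_
    rw [← ZMod.intCast_eq_zero_iff_even, Int.cast_add, ← rankParity_residue_unit,
      ← rankParity_residue_unit, ← map_add, ← map_add, h q]
  rcases hab with hab | hab
  · rw [hab, map_add, residue_unit_add_self hp]
  · rw [hab, neg_add_cancel, map_zero]

/-- The form is `⟨pr⟩ ⊕ ⟨r⟩` with `r ≡ 3 mod 4` prime and `r ≡ β mod p`. The summand `⟨r⟩` is there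
to cancel the residue of `⟨pr⟩` at `r`. -/
lemma exists_residue_eq_unit (hp : p % 4 = 1) (β : (ZMod p)ˣ) (hβ : ¬ IsSquare (β : ZMod p)) :
    ∃ a b : ℚˣ, residue p (unit a + unit b) = unit β ∧
      ∀ (q : ℕ) [Fact q.Prime], q ≠ p → residue q (unit a + unit b) = 0 := by
  have hpp : p.Prime := Fact.out
  obtain ⟨r, hr, hr4, hrp⟩ := ZMod.exists_prime_mod_four_eq_three (by omega) β
  have : Fact r.Prime := ⟨hr⟩
  have hne : r ≠ p := by rintro rfl; omega
  have hp0 : (p : ℚ) ≠ 0 := by exact_mod_cast hpp.ne_zero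
  have hr0 : (r : ℚ) ≠ 0 := by exact_mod_cast hr.ne_zero
  refine ⟨Units.mk0 (p * r) (mul_ne_zero hp0 hr0), Units.mk0 r hr0, ?_, fun q _ hq => ?_⟩
  · rw [map_add, residue_unit_prime_mul p r β (by simp [hrp]) _ (by simp),
      residue_unit_natCast_of_not_dvd (n := r) _ rfl, add_zero]
    exact fun hd => hne ((Nat.prime_dvd_prime_iff_eq hpp hr).mp hd).symm
  have hqp : q.Prime := Fact.out
  have hqp' : ¬ q ∣ p := fun hd => hq ((Nat.prime_dvd_prime_iff_eq hqp hpp).mp hd)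
  by_cases hqr : q = r
  · subst hqr
    have hu : IsUnit (p : ZMod q) := by
      rw [ZMod.isUnit_iff_coprime]
      exact (Nat.coprime_primes hpp hqp).mpr (Ne.symm hq)
    -- At `q = r` the residue is `[p] + [1]`, which vanishes if `-p` is a square modulo `r`. As `r ≡
    -- 3 mod 4`, it suffices that `p` is a non-square there, and by reciprocity this means that `r ≡
    -- β` is a non-square modulo `p`.
    rw [map_add, residue_unit_prime_mul q p hu.unit (by simp) _ (by simp [mul_comm]),
      residue_unit_prime_mul q 1 1 (by simp) _ (by simp), unit_add_unit_eq_zero_iff]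
    rw [Units.val_one, mul_one, IsUnit.unit_spec]
    refine ZMod.isSquare_neg_of_not_isSquare hr4 ?_
    rw [← ZMod.exists_sq_eq_prime_iff_of_mod_four_eq_one hp (by omega), hrp]
    exact hβ
  · have hqr' : ¬ q ∣ r := fun hd => hqr ((Nat.prime_dvd_prime_iff_eq hqp hr).mp hd)
    rw [map_add, residue_unit_natCast_of_not_dvd (n := p * r) _ (by simp),
      residue_unit_natCast_of_not_dvd (n := r) hqr' rfl, add_zero]
    exact fun hd => (hqp.dvd_mul.mp hd).elim hqp' hqr'

end Residue

/-! ### The Witt span and the theorem. -/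

lemma boundary_eq_iff {v w : WittGroup ℚ} : boundary v = boundary w ↔
    ∀ (q : ℕ) [Fact q.Prime], residue q v = residue q w :=
  ⟨fun h q hq => congrFun h ⟨q, hq.out⟩, fun h => funext fun q => h q⟩

lemma wittSpan_eq {w : WittGroup ℚ} {A : SymForm ℚ} (hA : boundary (mk A) = boundary w)
    (h : ∀ B : SymForm ℚ, boundary (mk B) = boundary w → A.rank ≤ B.rank) :
    w.wittSpan = A.rank :=
  -- The form `A` also shows that the set of ranks is non-empty, so the infimum is not the default
  -- value `0`.
  le_antisymm (Nat.sInf_le ⟨A, rfl, hA⟩) <| le_csInf ⟨_, A, rfl, hA⟩ <| by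
    rintro _ ⟨B, rfl, hB⟩
    exact h B hB

/-- Freeing the index type from `A.rank` lets the sums of length `0`, `1` and `2` be expanded. -/
lemma exists_mk_eq_of_rank {n : ℕ} (A : SymForm ℚ) (h : A.rank = n) :
    ∃ a : Fin n → ℚˣ, mk A = ∑ i, unit (a i) := by
  subst h
  exact mk_eq_sum_unit two_ne_zero A

end WittGroup

open WittGroup in
theorem theorem1p5 (K : Knot) (W : WittGroup ℚ) (hW : K.IsWittClass W)
    (p : ℕ) [Fact p.Prime] (hp : p % 4 = 1)
    (β : (ZMod p)ˣ) (hβ : ¬ IsSquare (β : ZMod p))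
    (hq : ∀ (q : ℕ) [Fact q.Prime], q ≠ p → WittGroup.residue q W = 0) :
    (WittGroup.residue p W = WittGroup.unit β → W.wittSpan = 2) ∧
    (WittGroup.residue p W = WittGroup.unit 1 + WittGroup.unit β → W.wittSpan = 3) := by
  have hpp : p.Prime := Fact.out
  obtain ⟨a, b, hab, hab'⟩ := exists_residue_eq_unit hp β hβ
  have hβ0 : unit β ≠ 0 := fun h => by simpa using congrArg (rankParity _) h
  -- Vanishing would make `-β`, and hence `β`, a square.
  have hβ1 : unit 1 + unit β ≠ 0 := fun h => hβ <| by
    rw [unit_add_unit_eq_zero_iff, Units.val_one, one_mul, neg_eq_neg_one_mul] at h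
    have := (ZMod.isSquare_neg_one_of_mod_four_eq_one hp).mul h
    rwa [← mul_assoc, neg_mul_neg, one_mul, one_mul] at this
  constructor
  · intro h
    let A := (SymForm.rankOne a).oplus (SymForm.rankOne b)
    have hA : A.rank = 2 := by
      change finrank ℚ (ℚ × ℚ) = 2
      simp
    rw [← hA]
    refine wittSpan_eq (A := A) (boundary_eq_iff.mpr fun q _ => ?_) fun B hB => ?_
    · change residue q (unit a + unit b) = _
      by_cases hqp : q = p
      · subst hqp
        rw [h]; exact hab
      · rw [hq q hqp, hab' q hqp]
    · rw [hA]
      by_contra! hlt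
      rw [boundary_eq_iff] at hB
      have hBp := (hB p).trans h
      obtain h0 | h1 : B.rank = 0 ∨ B.rank = 1 := by omega
      · obtain ⟨c, hc⟩ := exists_mk_eq_of_rank B h0
        rw [hc, Fin.sum_univ_zero, map_zero] at hBp
        exact hβ0 hBp.symm
      · obtain ⟨c, hc⟩ := exists_mk_eq_of_rank B h1
        rw [Fin.sum_univ_one] at hc
        rw [hc] at hB hBp
        rcases residue_unit_eq_zero_or_one hp (c 0)
          fun q _ hqp => (hB q).trans (hq q hqp) with h2 | h2
        · exact hβ0 (hBp.symm.trans h2)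
        -- If `[β] = [1]`, then `[1] + [β] = [1] + [1] = 0`.
        · refine hβ1 ?_
          rw [← hBp, h2, unit_add_self hp]
  · intro h
    let c : ℚˣ := Units.mk0 (p : ℚ) (by exact_mod_cast hpp.ne_zero)
    -- The extra summand `⟨p⟩` contributes `[1]` at `p` and nothing elsewhere.
    let A := (SymForm.rankOne c).oplus ((SymForm.rankOne a).oplus (SymForm.rankOne b))
    have hA : A.rank = 3 := by
      change finrank ℚ (ℚ × ℚ × ℚ) = 3
      simp
    rw [← hA]
    refine wittSpan_eq (A := A) (boundary_eq_iff.mpr fun q _ => ?_) fun B hB => ?_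
    · change residue q (unit c + (unit a + unit b)) = _
      rw [map_add]
      by_cases hqp : q = p
      · subst hqp
        rw [h, residue_unit_prime_mul q 1 1 (by simp) c (by simp [c]), hab]
      · rw [hq q hqp, hab' q hqp, residue_unit_natCast_of_not_dvd (n := p) _ rfl, add_zero]
        exact fun hd => hqp ((Nat.prime_dvd_prime_iff_eq Fact.out hpp).mp hd)
    · rw [hA]
      by_contra! hlt
      rw [boundary_eq_iff] at hB
      have hBp := (hB p).trans h
      -- The residue at `p` has rank parity `1 + 1 = 0` and the others vanish. In rank at most two
      -- this alone kills the residue at `p`.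
      have hpar : ∀ (q : ℕ) [Fact q.Prime], rankParity _ (residue q (mk B)) = 0 := fun q _ => by
        by_cases hqp : q = p
        · subst hqp
          rw [hBp, map_add, rankParity_unit, rankParity_unit]
          rfl
        · rw [hB q, hq q hqp, map_zero]
      refine hβ1 (hBp.symm.trans ?_)
      obtain h0 | h1 | h2 : B.rank = 0 ∨ B.rank = 1 ∨ B.rank = 2 := by omega
      · obtain ⟨d, hd⟩ := exists_mk_eq_of_rank B h0
        rw [hd, Fin.sum_univ_zero, map_zero]
      · obtain ⟨d, hd⟩ := exists_mk_eq_of_rank B h1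
        rw [Fin.sum_univ_one] at hd
        rw [hd] at hpar ⊢
        refine residue_unit_of_even p ?_
        rw [← ZMod.intCast_eq_zero_iff_even, ← rankParity_residue_unit, hpar]
      · obtain ⟨d, hd⟩ := exists_mk_eq_of_rank B h2
        rw [Fin.sum_univ_two] at hd
        rw [hd] at hpar ⊢
        exact residue_unit_add_unit_eq_zero hp _ _ hpar

end
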